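/- **Local running time of sphere routing.** *Network.* Let $G_0=(V_0,E_0)$ be the graph of the icosahedron. Given $(V_i,E_i)$, put a new vertex on every edge of $E_i$; the set of new vertices is $L_{i+1}$, and $V_{i+1}=V_i\cup L_{i+1}$. The edge set $E_{i+1}$ joins every new vertex to the two ends of its edge, and joins two new vertices whenever their edges are two sides of a triangle of $(V_i,E_i)$. The network is $G_k=(V_k,\bigcup_{i\le k}E_i)$, with $N=|V_k|$ nodes. The layer $l(\alpha)$ is the $i$ with $\alpha\in L_i$ (where $L_0=V_0$), $N(\alpha)$ is the set of neighbours of $\alpha$, and $N^\alpha=\{\gamma: d(\alpha,\gamma)\le 6\}$. *Labels.* The parents $p(\alpha)$ of $\alpha$ are its neighbours on lower layers, and $p(A)=\bigcup_{\alpha\in A}p(\alpha)$. Let $p^{\rm good}(A)$ be the set of the elements of $p(A)$ on the lowest layer that occurs in $p(A)$. With $B=p^{\rm good}(A)$ let $f(A)=B$ if $B$ meets $V_0$, and $f(A)=\{\beta\in B: p(\beta)\cap p^{\rm good}(B)\neq\emptyset\}$ otherwise. The label of $\alpha$ is the list of sets $\lambda(\alpha)=[A_1,\dots,A_n]$ with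 $A_1=\{\alpha\}$, $A_{i+1}=f(A_i)$, that stops at the first $A_n$ which meets $V_0$. Let $\Lambda_\beta=\bigcup_j\lambda(\beta)_j$. *Local routing algorithm at a node $\alpha$, for a destination $\beta$.* 1. If $\alpha=\beta$, report that the destination is reached. 2. Otherwise, if $\alpha\in\lambda(\beta)_i$ for some $i$, return a random element of $\lambda(\beta)_{i-1}\cap N(\alpha)$. 3. Otherwise, if $\Lambda_\beta\cap N^\alpha\ne\emptyset$, return a shortest one among the Dijkstra paths (in the subgraph induced by $N^\alpha$) from $\alpha$ to the nodes of $\Lambda_\beta\cap N^\alpha$, as the list of the next nodes after $\alpha$. 4. Otherwise return a random element of $\lambda(\alpha)_2$. *Cost model.* The input is the ID of $\beta$ and its label. The node $\alpha$ has stored its own ID and label, the set $N(\alpha)$, and a hash table which gives for every $\gamma\in N^\alpha$ a precomputed shortest path from $\alpha$ to $\gamma$ in the subgraph induced by $N^\alpha$. Sets of nodes are stored as hash sets. Each of the following operations costs one unit of time: comparing two IDs or two numbers, adding one, drawing a random number from $\{0,\dots,n\}$, reading the first cell of a list, putting an element in front of a list, and creating, inserting into, testing membership in, taking the size of, accessing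 the element list of, or looking up in a hash set or hash table. The algorithm is implemented in these operations: step 2 searches for $\alpha$ by one membership test per row of $\lambda(\beta)$; $\Lambda_\beta$ is built by inserting all its elements; an intersection of two sets is computed by looking up every element of the smaller one in the other one; the minimum in step 3 is found by traversing the stored paths of all elements of $\Lambda_\beta\cap N^\alpha$; a random element of a list is found by traversing the list. **Theorem.** There is a constant $C$ such that for all $k\ge 0$ and all nodes $\alpha,\beta$ of $G_k$, with the data stored correctly (in any order of the elements of the hash sets): the implementation has at least one run at $\alpha$ for the destination $\beta$, and every run, whatever the random choices, returns a result that the algorithm above allows and takes at most $C\log N$ units of time. That is, the running time per node of the local routing algorithm is $O(\log N)$. -/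

import Mathlib

namespace SphereRouting

/-! ## The graph of the subdivided icosahedron -/

/-- The 30 edges of the icosahedron: `0` and `11` are the two poles, `1,…,5` is the upper and
`6,…,10` the lower ring. -/
def icosahedronEdges : List (Fin 12 × Fin 12) :=
  [(0, 1), (0, 2), (0, 3), (0, 4), (0, 5),
   (1, 2), (2, 3), (3, 4), (4, 5), (5, 1),
   (1, 6), (1, 7), (2, 7), (2, 8), (3, 8), (3, 9), (4, 9), (4, 10), (5, 10), (5, 6),
   (6, 7), (7, 8), (8, 9), (9, 10), (10, 6),
   (11, 6), (11, 7), (11, 8), (11, 9), (11, 10)]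

/-- The graph of the icosahedron. -/
def icosahedron : SimpleGraph (Fin 12) where
  Adj a b := (a, b) ∈ icosahedronEdges ∨ (b, a) ∈ icosahedronEdges
  symm := ⟨fun _ _ h => h.symm⟩
  loopless := ⟨by decide⟩

/-- The state of the subdivision procedure after some number `i` of rounds: the vertex set `V_i`,
the layer of every vertex, the edges `E_i` made in round `i`, and the union of all `E_j`,
`j ≤ i`. -/
structure Stage where
  V : Type
  fintype : Fintype V
  layer : V → ℕ
  newest : SimpleGraph V
  graph : SimpleGraph V

attribute [instance] Stage.fintype

/-- Adjacency in the edge set made by one round of subdivision of `T`: a new vertex is placed on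
every edge of `T`. It is joined to the two ends of its edge, and to the new vertices on those edges
that are another side of a triangle of `T` containing its edge. -/
def subdivideAdj {V : Type} (T : SimpleGraph V) : V ⊕ T.edgeSet → V ⊕ T.edgeSet → Prop
  | .inl _, .inl _ => False
  | .inl a, .inr e => a ∈ e.1
  | .inr e, .inl a => a ∈ e.1
  | .inr e, .inr f =>
      ∃ a b c, T.Adj a b ∧ T.Adj a c ∧ T.Adj b c ∧ e.1 = s(a, b) ∧ f.1 = s(a, c)

/-- The edges made by one round of subdivision of `T`. -/
def subdivideEdges {V : Type} (T : SimpleGraph V) : SimpleGraph (V ⊕ T.edgeSet) where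
  Adj := subdivideAdj T
  symm := ⟨by
    rintro (a | e) (b | f) h
    · exact h
    · exact h
    · exact h
    · obtain ⟨a, b, c, hab, hac, hbc, he, hf⟩ := h
      exact ⟨a, c, b, hac, hab, hbc.symm, hf, he⟩⟩
  loopless := ⟨by
    rintro (a | e) h
    · exact h
    · obtain ⟨a, b, c, hab, hac, hbc, he, hf⟩ := h
      rw [he] at hf
      exact hbc.ne (Sym2.congr_right.mp hf)⟩

/-- One round of subdivision; the new vertices form layer `i`. -/
noncomputable def Stage.subdivide (S : Stage) (i : ℕ) : Stage where
  V := S.V ⊕ S.newest.edgeSet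
  fintype := Fintype.ofFinite _
  layer := Sum.elim S.layer (fun _ => i)
  newest := subdivideEdges S.newest
  graph := S.graph.map Function.Embedding.inl ⊔ subdivideEdges S.newest

/-- The icosahedron after `k` rounds of subdivision. -/
noncomputable def sphere : ℕ → Stage
  | 0 => { V := Fin 12
           fintype := inferInstance
           layer := fun _ => 0
           newest := icosahedron
           graph := icosahedron }
  | k + 1 => (sphere k).subdivide (k + 1)

/-- The nodes of the network obtained by `k` subdivisions. -/
abbrev Node (k : ℕ) : Type := (sphere k).V

/-- The network graph `G_k = (V_k, E_0 ∪ ⋯ ∪ E_k)`. -/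
noncomputable abbrev network (k : ℕ) : SimpleGraph (Node k) := (sphere k).graph

/-- The layer of a node, that is, the round in which it was made. -/
noncomputable abbrev layer {k : ℕ} (a : Node k) : ℕ := (sphere k).layer a

/-! ## Labels -/

open Classical in
/-- The parents of a node: its neighbours on lower layers. -/
noncomputable def parents {k : ℕ} (a : Node k) : Finset (Node k) :=
  {b | (network k).Adj a b ∧ layer b < layer a}

open Classical in
/-- The parents of the members of a set of nodes. -/
noncomputable def parentsOf {k : ℕ} (A : Finset (Node k)) : Finset (Node k) :=
  A.biUnion parents

open Classical in
/-- The parents of the members of `A` that are on the lowest layer among all of these parents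
(parent rule). -/
noncomputable def goodParents {k : ℕ} (A : Finset (Node k)) : Finset (Node k) :=
  {b ∈ parentsOf A | ∀ c ∈ parentsOf A, layer b ≤ layer c}

open Classical in
/-- The good parents of `A` that are not ruled out by the grandparent rule. -/
noncomputable def nextRow {k : ℕ} (A : Finset (Node k)) : Finset (Node k) :=
  if ∃ b ∈ goodParents A, layer b = 0 then goodParents A
  else {b ∈ goodParents A | (parents b ∩ goodParents (goodParents A)).Nonempty}

theorem nextRow_subset {k : ℕ} (A : Finset (Node k)) : nextRow A ⊆ parentsOf A := by
  classical
  intro b hb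
  have hb2 : b ∈ goodParents A := by
    unfold nextRow at hb
    split_ifs at hb with h
    · exact hb
    · exact (Finset.mem_filter.mp hb).1
  exact (Finset.mem_filter.mp hb2).1

theorem sup_layer_nextRow_lt {k : ℕ} (A : Finset (Node k)) (hA : A.Nonempty)
    (h : ∀ a ∈ A, layer a ≠ 0) : (nextRow A).sup layer < A.sup layer := by
  classical
  obtain ⟨a, ha⟩ := hA
  have hpos : 0 < A.sup layer :=
    lt_of_lt_of_le (Nat.pos_of_ne_zero (h a ha)) (Finset.le_sup (f := layer) ha)
  refine (Finset.sup_lt_iff (by simpa using hpos)).mpr fun b hb => ?_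
  obtain ⟨c, hc, hbc⟩ := Finset.mem_biUnion.mp (nextRow_subset A hb)
  exact lt_of_lt_of_le (Finset.mem_filter.mp hbc).2.2 (Finset.le_sup (f := layer) hc)

open Classical in
/-- `[A]` if `A` contains a node of layer `0`, and `A` followed by the label of `nextRow A`
otherwise. (The empty set, for which this recursion would not end, never occurs as a row of the
label of a node.) -/
noncomputable def labelOfSet {k : ℕ} (A : Finset (Node k)) : List (Finset (Node k)) :=
  if h : A.Nonempty ∧ ∀ a ∈ A, layer a ≠ 0 then A :: labelOfSet (nextRow A) else [A]
termination_by A.sup layer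
decreasing_by exact sup_layer_nextRow_lt A h.1 h.2

/-- The label of a node, a list of sets of nodes. -/
noncomputable def label {k : ℕ} (a : Node k) : List (Finset (Node k)) := labelOfSet {a}

/-- All nodes that occur in the label of `b`. -/
def labelNodes {k : ℕ} (b : Node k) : Set (Node k) := {c | ∃ A ∈ label b, c ∈ A}

/-- The sixth-order neighbourhood of a node. -/
def sixBall {k : ℕ} (a : Node k) : Set (Node k) := {c | (network k).edist a c ≤ 6}

/-- `P` is (the list of vertices, both ends included, of) a shortest path from `a` to `c` in the
subgraph induced by the sixth-order neighbourhood of `a`: a possible result of Dijkstra's algorithm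
on this subgraph. -/
def IsDijkstraPath {k : ℕ} (a c : Node k) (P : List (Node k)) : Prop :=
  ∃ w : (network k).Walk a c, w.IsPath ∧ (∀ v ∈ w.support, v ∈ sixBall a) ∧ w.support = P ∧
    ∀ u : (network k).Walk a c, (∀ v ∈ u.support, v ∈ sixBall a) → w.length ≤ u.length

/-! ## What the local routing algorithm returns -/

/-- Results of the routing algorithm. -/
inductive Outcome (V : Type) : Type
  | destinationReached : Outcome V
  | route (nodes : List V) : Outcome V
  | failure : Outcome V

/-- The results that the local routing algorithm may return at the node `a` for the destination
`b`. Random choices account for there being several of them. The list in `route` consists of the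
next nodes on the way, without `a` itself. -/
inductive Allowed {k : ℕ} (a b : Node k) : Outcome (Node k) → Prop
  /-- The destination is reached. -/
  | reached (h : a = b) : Allowed a b .destinationReached
  /-- The node `a` is in row `i + 1` of the label of `b`: go to a neighbour in row `i`. -/
  | up (h : a ≠ b) (i : ℕ) (A B : Finset (Node k)) (hB : (label b)[i]? = some B)
      (hA : (label b)[i + 1]? = some A) (ha : a ∈ A) (c : Node k) (hc : c ∈ B)
      (hac : (network k).Adj a c) : Allowed a b (.route [c])
  /-- Some node of the label of `b` is near: take a shortest path to a nearest such node. -/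
  | near (h : a ≠ b) (ha : a ∉ labelNodes b) (c : Node k) (hc : c ∈ sixBall a ∩ labelNodes b)
      (P : List (Node k)) (hP : IsDijkstraPath a c P)
      (hmin : ∀ d ∈ sixBall a ∩ labelNodes b, ∀ Q, IsDijkstraPath a d Q → P.length ≤ Q.length) :
      Allowed a b (.route P.tail)
  /-- No node of the label of `b` is near: go to a node of the second row of the label of `a`. -/
  | down (h : a ≠ b) (ha : a ∉ labelNodes b) (hfar : sixBall a ∩ labelNodes b = ∅)
      (A : Finset (Node k)) (hA : (label a)[1]? = some A) (c : Node k) (hc : c ∈ A) :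
      Allowed a b (.route [c])

/-! ## The uniform cost model with hashing -/

/-- A hash set of node IDs. It can be traversed in some order, given by `elems`. -/
structure HashSet (V : Type) where
  elems : List V
  nodup : elems.Nodup

/-- A hash table with node IDs as keys. -/
structure HashTable (V W : Type) where
  keys : HashSet V
  value : V → W

/-- The elementary operations on node IDs of type `V`, natural numbers, (linked) lists, hash sets
and hash tables; the index is the type of the result. -/
inductive Op (V : Type) : Type → Type 1
  /-- Are two IDs equal? -/
  | sameId (a b : V) : Op V Bool
  /-- Are two numbers equal? -/
  | sameNat (m n : ℕ) : Op V Bool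
  /-- Is `m < n`? -/
  | less (m n : ℕ) : Op V Bool
  /-- The number `n + 1`. -/
  | succ (n : ℕ) : Op V ℕ
  /-- A random element of `{0, …, n}`. -/
  | random (n : ℕ) : Op V ℕ
  /-- Read the first cell of a list, or learn that the list is empty. -/
  | uncons {α : Type} (l : List α) : Op V (Option (α × List α))
  /-- Put an element in front of a list. -/
  | cons {α : Type} (x : α) (l : List α) : Op V (List α)
  /-- Create an empty hash set. -/
  | newSet : Op V (HashSet V)
  /-- Insert an ID into a hash set. -/
  | insert (S : HashSet V) (x : V) : Op V (HashSet V)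
  /-- Is `x` in the hash set `S`? -/
  | mem (S : HashSet V) (x : V) : Op V Bool
  /-- The number of elements of a hash set. -/
  | size (S : HashSet V) : Op V ℕ
  /-- Access the first cell of the list of the elements of a hash set. -/
  | elems (S : HashSet V) : Op V (List V)
  /-- Look up the value stored under the key `x`, if any. -/
  | lookup {W : Type} (T : HashTable V W) (x : V) : Op V (Option W)

/-- `o.Result r` means that `r` is a possible result of the operation `o`. -/
def Op.Result {V : Type} : {α : Type} → Op V α → α → Prop
  | _, .sameId a b, r => (r = true ↔ a = b)
  | _, .sameNat m n, r => (r = true ↔ m = n)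
  | _, .less m n, r => (r = true ↔ m < n)
  | _, .succ n, r => r = n + 1
  | _, .random n, r => r ≤ n
  | _, .uncons [], r => r = none
  | _, .uncons (x :: l), r => r = some (x, l)
  | _, .cons x l, r => r = x :: l
  | _, .newSet, r => r.elems = []
  | _, .insert S x, r => ∀ y, y ∈ r.elems ↔ y = x ∨ y ∈ S.elems
  | _, .mem S x, r => (r = true ↔ x ∈ S.elems)
  | _, .size S, r => r = S.elems.length
  | _, .elems S, r => r = S.elems
  | _, .lookup T x, r =>
      (x ∈ T.keys.elems → r = some (T.value x)) ∧ (x ∉ T.keys.elems → r = none)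

/-- Programs: either return a value, or perform an elementary operation and go on in a way that
depends on its result. -/
inductive Prog (V : Type) : Type → Type 1
  | ret {α : Type} (x : α) : Prog V α
  | step {α β : Type} (o : Op V β) (next : β → Prog V α) : Prog V α

/-- Sequential composition. -/
def Prog.andThen {V α β : Type} : Prog V α → (α → Prog V β) → Prog V β
  | .ret x, f => f x
  | .step o next, f => .step o fun y => (next y).andThen f

instance (V : Type) : Monad (Prog V) where
  pure := Prog.ret
  bind := Prog.andThen

/-- The program that performs one elementary operation. -/
def op {V α : Type} (o : Op V α) : Prog V α := .step o .ret

/-- `Runs p r t`: some run of the program `p` (for some outcome of its random choices) returns `r`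
after exactly `t` elementary operations. Every elementary operation costs one unit of time; between
two operations a program only branches on results and keeps a bounded number of values at hand. -/
inductive Runs {V : Type} : {α : Type} → Prog V α → α → ℕ → Prop
  | ret {α : Type} (x : α) : Runs (.ret x) x 0
  | step {α β : Type} (o : Op V β) (next : β → Prog V α) (y : β) (x : α) (t : ℕ)
      (h : o.Result y) (hrun : Runs (next y) x t) : Runs (.step o next) x (t + 1)

/-! ## The implementation of the local routing algorithm -/

/-- Run through a list, updating a state; each cell of the list, and its end, has to be read. -/
def forEach {V α σ : Type} (l : List α) (s : σ) (body : σ → α → Prog V σ) : Prog V σ :=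
  match l with
  | [] => do
    let _ ← op (.uncons ([] : List α))
    return s
  | x :: rest => do
    let _ ← op (.uncons (x :: rest))
    let s ← body s x
    forEach rest s body

/-- The length of a list, by traversal. -/
def listLength {V α : Type} (l : List α) : Prog V ℕ :=
  forEach l 0 fun n _ => op (.succ n)

/-- A random element of a list, by traversal up to and beyond a random position. -/
def randomElement {V : Type} (l : List V) : Prog V (Option V) := do
  match ← op (.uncons l) with
  | none => return none
  | some (x, rest) =>
    let n ← listLength rest
    let i ← op (.random n)
    let (_, y) ← forEach rest (0, x) fun (j, y) z => do
      let j ← op (.succ j)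
      if ← op (.sameNat i j) then return (j, z) else return (j, y)
    return some y

/-- Take the elements of `S` that are in `S₂`. -/
def filterMem {V : Type} (S S₂ : HashSet V) : Prog V (List V) := do
  let l ← op (.elems S)
  forEach l [] fun acc x => do
    if ← op (.mem S₂ x) then op (.cons x acc) else return acc

/-- The intersection of two hash sets, by looking up the elements of the smaller one in the other
one. -/
def intersect {V : Type} (S S₂ : HashSet V) : Prog V (List V) := do
  let m ← op (.size S)
  let n ← op (.size S₂)
  if ← op (.less m n) then filterMem S S₂ else filterMem S₂ S

/-- The union of a list of hash sets. -/
def unionAll {V : Type} (rows : List (HashSet V)) : Prog V (HashSet V) := do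
  let empty ← op .newSet
  forEach rows empty fun acc row => do
    let l ← op (.elems row)
    forEach l acc fun acc x => op (.insert acc x)

/-- The row before a row that contains `a`, if there is such a row. -/
def rowBefore {V : Type} (a : V) (rows : List (HashSet V)) : Prog V (Option (HashSet V)) := do
  let (_, found) ← forEach rows ((none, none) : Option (HashSet V) × Option (HashSet V))
    fun (previous, found) row => do
      if ← op (.mem row a) then return (some row, previous) else return (some row, found)
  return found

/-- A shortest one among the paths that are stored in `T` under the keys in `l`. -/
def shortest {V : Type} (T : HashTable V (List V)) (l : List V) : Prog V (Option (List V)) := do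
  let best ← forEach l (none : Option (List V × ℕ)) fun best c => do
    match ← op (.lookup T c) with
    | none => return best
    | some P =>
      let n ← listLength P
      match best with
      | none => return some (P, n)
      | some (Q, m) => if ← op (.less n m) then return some (P, n) else return some (Q, m)
  return best.map Prod.fst

/-- The data that a node stores: its ID and its label, the set of its neighbours, and a table with
the nodes of its sixth-order neighbourhood and paths to them. -/
structure NodeData (V : Type) where
  self : V
  label : List (HashSet V)
  neighbours : HashSet V
  ball : HashTable V (List V)

/-- A routing request: the ID and the label of the destination. -/
structure Request (V : Type) where
  destination : V
  label : List (HashSet V)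

/-- Route to a random element of a list. -/
def routeToRandom {V : Type} (l : List V) : Prog V (Outcome V) := do
  match ← randomElement l with
  | none => return .failure
  | some c => return .route [c]

/-- The local routing algorithm, run by a node with data `D` on the request `q`. -/
def localRoute {V : Type} (D : NodeData V) (q : Request V) : Prog V (Outcome V) := do
  if ← op (.sameId D.self q.destination) then
    return .destinationReached
  else
    match ← rowBefore D.self q.label with
    | some row =>
      let l ← intersect row D.neighbours
      routeToRandom l
    | none =>
      let nodes ← unionAll q.label
      let near ← intersect nodes D.ball.keys
      match ← op (.uncons near) with
      | some _ =>
        match ← shortest D.ball near with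
        | none => return .failure
        | some P =>
          match ← op (.uncons P) with
          | none => return .failure
          | some (_, next) => return .route next
      | none =>
        match ← op (.uncons D.label) with
        | none => return .failure
        | some (_, rows) =>
          match ← op (.uncons rows) with
          | none => return .failure
          | some (row, _) =>
            let l ← op (.elems row)
            routeToRandom l

/-- The hash set `S` stores the set `A`. -/
def HashSet.Stores {V : Type} (S : HashSet V) (A : Set V) : Prop := ∀ x, x ∈ S.elems ↔ x ∈ A

/-- The list of hash sets `L` stores the label of `a`. -/
def StoresLabel {k : ℕ} (L : List (HashSet (Node k))) (a : Node k) : Prop :=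
  List.Forall₂ (fun S A => S.Stores (A : Set (Node k))) L (label a)

/-- `D` is the correct precomputed data for the node `a`. -/
structure NodeData.IsFor {k : ℕ} (D : NodeData (Node k)) (a : Node k) : Prop where
  self_eq : D.self = a
  label_eq : StoresLabel D.label a
  neighbours_eq : D.neighbours.Stores ((network k).neighborSet a)
  ball_eq : D.ball.keys.Stores (sixBall a)
  path_eq : ∀ c ∈ sixBall a, IsDijkstraPath a c (D.ball.value c)

/-- `q` is a correct request for routing to the node `b`. -/
structure Request.IsFor {k : ℕ} (q : Request (Node k)) (b : Node k) : Prop where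
  destination_eq : q.destination = b
  label_eq : StoresLabel q.label b

end SphereRouting

namespace SphereRouting

/-! ## Runs and their cost -/

section Programs

variable {V α β σ : Type}

/-! Since $N\ge 2^{k+1}$ (`two_pow_le_card_node`), a bound linear in $k+1$ suffices;
`costs_localRoute` gives $200(k+1)$.

A label has at most $k+1$ rows, because the maximal layer drops from row to row (`length_label_le`).
A row has at most three nodes (`card_le_of_mem_label`): rows are cliques within one layer, as
parents of equal or adjacent nodes of one layer are equal or adjacent (`eq_or_adj_of_mem_parents`),
and such a clique lives in a single $(V_j,E_j)$, which contains no four pairwise adjacent vertices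
(`card_le_three_of_isClique_newest`). So $\Lambda_\beta$ has at most $3(k+1)$ nodes. Stored paths
have at most seven nodes, and an intersection costs no more than its smaller side, so the sizes of
$N(\alpha)$ and $N^\alpha$ never matter.

No run fails. In step 2, a node of a row is a parent of some node of the row before, hence has a
neighbour there. In step 4, $\alpha$ is not on layer 0, because nodes of layer 0 are within distance
6 of each other and every label reaches layer 0; hence its label has a nonempty second row.

Costs and results are derived together by a calculus of postconditions, `Costs`. -/

theorem Op.exists_result (o : Op V α) : ∃ r, o.Result r := by
  classical
  cases o with
  | sameId a b => exact ⟨decide (a = b), by simp [Op.Result]⟩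
  | sameNat m n => exact ⟨decide (m = n), by simp [Op.Result]⟩
  | less m n => exact ⟨decide (m < n), by simp [Op.Result]⟩
  | succ n => exact ⟨_, rfl⟩
  | random n => exact ⟨n, le_refl n⟩
  | uncons l =>
    cases l with
    | nil => exact ⟨_, rfl⟩
    | cons x l => exact ⟨_, rfl⟩
  | cons x l => exact ⟨_, rfl⟩
  | newSet => exact ⟨⟨[], List.nodup_nil⟩, rfl⟩
  | insert S x =>
    by_cases h : x ∈ S.elems
    · refine ⟨S, fun y => ⟨Or.inr, ?_⟩⟩
      rintro (rfl | hy)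
      · exact h
      · exact hy
    · exact ⟨⟨x :: S.elems, List.nodup_cons.mpr ⟨h, S.nodup⟩⟩, fun y => List.mem_cons⟩
  | mem S x => exact ⟨decide (x ∈ S.elems), by simp [Op.Result]⟩
  | size S => exact ⟨_, rfl⟩
  | elems S => exact ⟨_, rfl⟩
  | lookup T x =>
    by_cases h : x ∈ T.keys.elems
    · exact ⟨some (T.value x), fun _ => rfl, fun h' => absurd h h'⟩
    · exact ⟨none, fun h' => absurd h' h, fun _ => rfl⟩

/-- `Costs` speaks of all runs and would be vacuous without any; this supplies one. -/
theorem Prog.exists_runs (p : Prog V α) : ∃ r t, Runs p r t := by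
  induction p with
  | ret x => exact ⟨x, 0, .ret x⟩
  | step o next ih =>
    obtain ⟨y, hy⟩ := o.exists_result
    obtain ⟨r, t, h⟩ := ih y
    exact ⟨r, t + 1, .step o next y r t hy h⟩

/-- Every run of `p` takes at most `c` units of time and returns a result that satisfies `Q`. -/
def Costs (p : Prog V α) (c : ℕ) (Q : α → Prop) : Prop := ∀ r t, Runs p r t → t ≤ c ∧ Q r

theorem Costs.mono {p : Prog V α} {c c' : ℕ} {Q Q' : α → Prop} (h : Costs p c Q) (hc : c ≤ c')
    (hQ : ∀ r, Q r → Q' r) : Costs p c' Q' :=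
  fun r t hr => ⟨(h r t hr).1.trans hc, hQ r (h r t hr).2⟩

theorem Costs.pure {x : α} {c : ℕ} {Q : α → Prop} (h : Q x) :
    Costs (Pure.pure x : Prog V α) c Q := by
  intro r t hr
  change Runs (Prog.ret x) r t at hr
  cases hr
  exact ⟨Nat.zero_le _, h⟩

theorem Runs.exists_of_andThen {p : Prog V α} {f : α → Prog V β} {r : β} {t : ℕ}
    (h : Runs (p.andThen f) r t) : ∃ x t₁ t₂, Runs p x t₁ ∧ Runs (f x) r t₂ ∧ t = t₁ + t₂ := by
  induction p generalizing t with
  | ret x => exact ⟨x, 0, t, .ret x, h, (Nat.zero_add t).symm⟩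
  | step o next ih =>
    cases h with
    | step _ _ y _ t ho hr =>
      obtain ⟨x, t₁, t₂, h₁, h₂, rfl⟩ := ih y hr
      exact ⟨x, t₁ + 1, t₂, .step o next y x t₁ ho h₁, h₂, by omega⟩

theorem Costs.bind {p : Prog V α} {f : α → Prog V β} {c₁ c₂ c : ℕ} {P : α → Prop} {Q : β → Prop}
    (hp : Costs p c₁ P) (hf : ∀ x, P x → Costs (f x) c₂ Q) (hc : c₁ + c₂ ≤ c) :
    Costs (p >>= f) c Q := by
  intro r t hr
  obtain ⟨x, t₁, t₂, h₁, h₂, rfl⟩ := Runs.exists_of_andThen (p := p) hr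
  obtain ⟨hp₁, hp₂⟩ := hp x t₁ h₁
  obtain ⟨hf₁, hf₂⟩ := hf x hp₂ r t₂ h₂
  exact ⟨by omega, hf₂⟩

theorem Costs.op {o : Op V α} {c : ℕ} {Q : α → Prop} (h : ∀ y, o.Result y → Q y) (hc : 1 ≤ c) :
    Costs (op o) c Q := by
  intro r t hr
  cases hr with
  | step _ _ y _ t ho hr =>
    cases hr
    exact ⟨hc, h _ ho⟩

theorem Costs.op_bind {o : Op V α} {f : α → Prog V β} {c : ℕ} {Q : β → Prop}
    (h : ∀ y, o.Result y → Costs (f y) c Q) : Costs (SphereRouting.op o >>= f) (c + 1) Q :=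
  Costs.bind (Costs.op (fun _ hy => hy) le_rfl) h (by omega)

/-- The cost of a loop whose body preserves the invariant `I`, a property of the part of the list
that has been processed and of the state. -/
theorem Costs.forEach_of_invariant (I : List α → σ → Prop) (c : α → ℕ) {body : σ → α → Prog V σ}
    (l pre : List α) (s : σ) (hs : I pre s)
    (hbody : ∀ x ∈ l, ∀ pre s, I pre s → Costs (body s x) (c x) (I (pre ++ [x]))) :
    Costs (forEach l s body) ((l.map fun x => c x + 1).sum + 1) (I (pre ++ l)) := by
  induction l generalizing pre s with
  | nil =>
    rw [forEach, List.append_nil]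
    -- The final unit of the bound pays for reading the end of the list.
    exact Costs.op_bind (c := 0) fun _ _ => Costs.pure hs
  | cons x l ih =>
    rw [forEach]
    refine Costs.op_bind fun _ _ => ?_
    refine Costs.bind (hbody x List.mem_cons_self pre s hs) (fun s' hs' => ?_)
      (c₂ := (l.map fun x => c x + 1).sum + 1) ?_
    · have := ih (pre ++ [x]) s' hs' fun y hy => hbody y (List.mem_cons_of_mem _ hy)
      rwa [List.append_assoc] at this
    · simp only [List.map_cons, List.sum_cons]
      omega

theorem Costs.forEach (I : List α → σ → Prop) (c : ℕ) {body : σ → α → Prog V σ}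
    {l : List α} {s : σ} (hs : I [] s)
    (hbody : ∀ x ∈ l, ∀ pre s, I pre s → Costs (body s x) c (I (pre ++ [x]))) :
    Costs (forEach l s body) ((c + 1) * l.length + 1) (I l) := by
  refine (Costs.forEach_of_invariant I (fun _ => c) l [] s hs hbody).mono ?_ fun _ h => h
  simp [mul_comm]

/-! ## The parts of the implementation -/

theorem costs_listLength (l : List α) :
    Costs (listLength l : Prog V ℕ) (2 * l.length + 1) fun n => n = l.length := by
  refine Costs.forEach (fun pre n => n = pre.length) 1 rfl fun x _ pre n hn => ?_
  exact Costs.op (fun y hy => by rw [show y = n + 1 from hy, hn]; simp) le_rfl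

theorem costs_randomElement (l : List V) :
    Costs (randomElement l) (5 * l.length + 4)
      fun r => (l = [] ∧ r = none) ∨ ∃ y ∈ l, r = some y := by
  unfold randomElement
  refine Costs.op_bind fun y hy => ?_
  cases l with
  | nil =>
    cases (show y = none from hy)
    exact Costs.pure (Or.inl ⟨rfl, rfl⟩)
  | cons x l =>
    cases (show y = some (x, l) from hy)
    refine Costs.bind (costs_listLength l) (c₂ := 3 * l.length + 2) (fun n _ => ?_)
      (by simp only [List.length_cons]; omega)
    refine Costs.op_bind fun i _ => ?_
    -- The random position is irrelevant here: the invariant only says that the current candidate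
    -- belongs to the list.
    refine Costs.bind
      (Costs.forEach (fun _ (s : ℕ × V) => s.2 ∈ x :: l) 2 List.mem_cons_self ?_)
      (c₂ := 0) (fun s hs => Costs.pure (Or.inr ⟨s.2, hs, rfl⟩)) le_rfl
    intro z hz _ s hs
    refine Costs.op_bind fun j _ => Costs.op_bind fun b _ => ?_
    split_ifs
    · exact Costs.pure (List.mem_cons_of_mem _ hz)
    · exact Costs.pure hs

theorem costs_filterMem (S S₂ : HashSet V) :
    Costs (filterMem S S₂) (3 * S.elems.length + 2)
      fun l => (∀ x, x ∈ l ↔ x ∈ S.elems ∧ x ∈ S₂.elems) ∧ l.length ≤ S.elems.length := by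
  unfold filterMem
  refine Costs.op_bind fun l hl => ?_
  cases (show l = S.elems from hl)
  refine Costs.forEach (fun pre (acc : List V) => (∀ x, x ∈ acc ↔ x ∈ pre ∧ x ∈ S₂.elems) ∧
    acc.length ≤ pre.length) 2 (by simp) ?_
  rintro x _ pre acc ⟨h, hlen⟩
  refine Costs.op_bind fun b hb => ?_
  have hb : b = true ↔ x ∈ S₂.elems := hb
  split_ifs with hbt
  · refine Costs.op (fun r hr => ?_) le_rfl
    cases (show r = x :: acc from hr)
    refine ⟨fun y => ?_, by simpa using hlen⟩
    by_cases hy : y = x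
    · simp [hy, hb.mp hbt]
    · simp [hy, h]
  · refine Costs.pure ⟨fun y => ?_, by simp; omega⟩
    by_cases hy : y = x
    · have := mt hb.mpr hbt
      simp [hy, h, this]
    · simp [hy, h]

/-- The size of `S₂` does not enter: `S₂` is traversed only when it is no larger than `S`. This is
why neither neighbourhood has to be bounded later. -/
theorem costs_intersect (S S₂ : HashSet V) :
    Costs (intersect S S₂) (3 * S.elems.length + 5)
      fun l => (∀ x, x ∈ l ↔ x ∈ S.elems ∧ x ∈ S₂.elems) ∧ l.length ≤ S.elems.length := by
  unfold intersect
  refine Costs.op_bind fun m hm => Costs.op_bind fun n hn => Costs.op_bind fun b hb => ?_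
  have hb : b = true ↔ m < n := hb
  rw [show m = S.elems.length from hm, show n = S₂.elems.length from hn] at hb
  split_ifs with h
  · exact costs_filterMem S S₂
  · have hlt := mt hb.mpr h
    exact (costs_filterMem S₂ S).mono (by omega) fun l hl =>
      ⟨fun x => (hl.1 x).trans and_comm, by omega⟩

theorem HashSet.length_le_of_subset (S : HashSet V) {l : List V} (h : ∀ x ∈ S.elems, x ∈ l) :
    S.elems.length ≤ l.length :=
  (List.subperm_of_subset S.nodup h).length_le

theorem costs_unionAll (rows : List (HashSet V)) (n : ℕ) (hn : ∀ R ∈ rows, R.elems.length ≤ n) :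
    Costs (unionAll rows) ((2 * n + 3) * rows.length + 2)
      fun S => (∀ x, x ∈ S.elems ↔ ∃ R ∈ rows, x ∈ R.elems) ∧
        S.elems.length ≤ n * rows.length := by
  unfold unionAll
  refine Costs.op_bind fun S hS => ?_
  have hS : S.elems = [] := hS
  refine (Costs.forEach (fun pre S => ∀ x, x ∈ S.elems ↔ ∃ R ∈ pre, x ∈ R.elems) (2 * n + 2)
    (by simp [hS]) ?_).mono le_rfl ?_
  · intro R hR pre S hS
    refine Costs.op_bind fun l hl => ?_
    cases (show l = R.elems from hl)
    refine (Costs.forEach (fun done T => ∀ x, x ∈ T.elems ↔ x ∈ S.elems ∨ x ∈ done) 1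
      (by simp) ?_).mono (by have := hn R hR; omega) ?_
    · intro y _ done T hT
      refine Costs.op (fun U hU x => ?_) le_rfl
      rw [show x ∈ U.elems ↔ _ from hU x, hT]
      simp only [List.mem_append, List.mem_singleton]
      tauto
    · intro T hT x
      rw [hT, hS]
      simp only [List.mem_append, List.mem_singleton, or_and_right, exists_or, exists_eq_left]
  · intro S hS
    refine ⟨hS, ?_⟩
    -- Membership alone bounds the size, since a hash set has no duplicates: compare with the
    -- concatenation of the rows.
    refine (S.length_le_of_subset (l := rows.flatMap HashSet.elems) fun x hx => ?_).trans ?_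
    · simpa [List.mem_flatMap] using (hS x).mp hx
    · rw [List.length_flatMap, mul_comm]
      simpa using List.sum_le_card_nsmul (rows.map fun R => R.elems.length) n (by simpa using hn)

/-- Without `hhead`, a hit in the first row, which has no predecessor, would be reported as `none`,
just like a miss. With several hits the last one wins. -/
theorem costs_rowBefore (a : V) (rows : List (HashSet V))
    (hhead : ∀ R, rows[0]? = some R → a ∉ R.elems) :
    Costs (rowBefore a rows) (2 * rows.length + 1)
      fun r => (r = none ∧ ∀ R ∈ rows, a ∉ R.elems) ∨
        ∃ i R S, rows[i]? = some R ∧ rows[i + 1]? = some S ∧ a ∈ S.elems ∧ r = some R := by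
  unfold rowBefore
  -- The premise `pre <+: rows` identifies the current row as the head of `rows` when `pre` is
  -- empty, so that `hhead` applies.
  refine Costs.bind (Costs.forEach_of_invariant (fun pre s => pre <+: rows → s.1 = pre.getLast? ∧
    ((s.2 = none ∧ ∀ R ∈ pre, a ∉ R.elems) ∨
      ∃ i R S, pre[i]? = some R ∧ pre[i + 1]? = some S ∧ a ∈ S.elems ∧ s.2 = some R))
    (fun _ => 1) rows [] _ (by simp) ?_) (c₂ := 0)
    (fun s hs => Costs.pure (hs List.prefix_rfl).2) (by simp [mul_comm])
  intro T hT pre s hs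
  refine Costs.op_bind fun b hb => ?_
  have hb : b = true ↔ a ∈ T.elems := hb
  split_ifs with hbt
  · refine Costs.pure fun hpre => ⟨by simp, Or.inr ?_⟩
    have hs := hs ((List.prefix_append _ _).trans hpre)
    rcases List.eq_nil_or_concat pre with rfl | ⟨pre', R, rfl⟩
    · refine absurd (hb.mp hbt) (hhead T ?_)
      obtain ⟨t, rfl⟩ := hpre
      simp
    · refine ⟨pre'.length, R, T, by simp, ?_, hb.mp hbt, by simpa using hs.1⟩
      simp
  · refine Costs.pure fun hpre => ⟨by simp, ?_⟩
    rcases (hs ((List.prefix_append _ _).trans hpre)).2 with h | ⟨i, R, S, hR, hS, h⟩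
    · refine Or.inl ⟨h.1, fun R hR => ?_⟩
      rcases List.mem_append.mp hR with hR | hR
      · exact h.2 R hR
      · rw [List.mem_singleton.mp hR]
        exact mt hb.mpr hbt
    · refine Or.inr ⟨i, R, S, ?_, ?_, h⟩
      · rw [List.getElem?_append_left (List.getElem?_eq_some_iff.mp hR).1, hR]
      · rw [List.getElem?_append_left (List.getElem?_eq_some_iff.mp hS).1, hS]

theorem costs_shortest (T : HashTable V (List V)) (l : List V) (n : ℕ) (hl : l ≠ [])
    (hkeys : ∀ c ∈ l, c ∈ T.keys.elems) (hn : ∀ c ∈ l, (T.value c).length ≤ n) :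
    Costs (shortest T l) ((2 * n + 4) * l.length + 1)
      fun r => ∃ c ∈ l, r = some (T.value c) ∧ ∀ d ∈ l, (T.value c).length ≤ (T.value d).length := by
  unfold shortest
  refine Costs.bind (Costs.forEach (fun pre (s : Option (List V × ℕ)) => (pre = [] ∧ s = none) ∨
    ∃ c ∈ l, s = some (T.value c, (T.value c).length) ∧
      ∀ d ∈ pre, (T.value c).length ≤ (T.value d).length) (2 * n + 3) (Or.inl ⟨rfl, rfl⟩) ?_)
    (c₂ := 0) ?_ le_rfl
  · intro x hx pre s hs
    refine Costs.op_bind fun y hy => ?_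
    cases (show y = some (T.value x) from hy.1 (hkeys x hx))
    refine Costs.bind (costs_listLength (T.value x)) (c₂ := 1) (fun m hm => ?_)
      (by have := hn x hx; omega)
    subst hm
    rcases hs with ⟨rfl, rfl⟩ | ⟨c, hc, rfl, hmin⟩
    · exact Costs.pure (Or.inr ⟨x, hx, rfl, by simp⟩)
    · refine Costs.op_bind fun b hb => ?_
      have hb : b = true ↔ (T.value x).length < (T.value c).length := hb
      split_ifs with hbt
      · refine Costs.pure (Or.inr ⟨x, hx, rfl, fun d hd => ?_⟩)
        rcases List.mem_append.mp hd with hd | hd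
        · exact ((hb.mp hbt).trans_le (hmin d hd)).le
        · rw [List.mem_singleton.mp hd]
      · refine Costs.pure (Or.inr ⟨c, hc, rfl, fun d hd => ?_⟩)
        rcases List.mem_append.mp hd with hd | hd
        · exact hmin d hd
        · rw [List.mem_singleton.mp hd]
          exact not_lt.mp (mt hb.mpr hbt)
  · rintro s (⟨h, -⟩ | ⟨c, hc, rfl, hmin⟩)
    · exact absurd h hl
    · exact Costs.pure ⟨c, hc, rfl, hmin⟩

theorem costs_routeToRandom (l : List V) (hl : l ≠ []) :
    Costs (routeToRandom l) (5 * l.length + 4) fun r => ∃ c ∈ l, r = .route [c] := by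
  unfold routeToRandom
  refine Costs.bind (costs_randomElement l) (c₂ := 0) ?_ le_rfl
  rintro r (⟨h, -⟩ | ⟨c, hc, rfl⟩)
  · exact absurd h hl
  · exact Costs.pure ⟨c, hc, rfl⟩

end Programs

/-! ## The geometry of the network -/

section Geometry

variable {k : ℕ}

/-- A node of `G_k` as a node of `G_{k+1}`. -/
def oldNode (a : Node k) : Node (k + 1) := Sum.inl a

/-- The node of `G_{k+1}` on an edge of `(V_k, E_k)`. -/
def newNode (e : (sphere k).newest.edgeSet) : Node (k + 1) := Sum.inr e

theorem node_cases (x : Node (k + 1)) : (∃ a, x = oldNode a) ∨ ∃ e, x = newNode e := by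
  rcases (x : (sphere k).V ⊕ (sphere k).newest.edgeSet) with a | e
  · exact Or.inl ⟨a, rfl⟩
  · exact Or.inr ⟨e, rfl⟩

theorem oldNode_injective : Function.Injective (oldNode : Node k → Node (k + 1)) :=
  Sum.inl_injective

theorem newNode_injective :
    Function.Injective (newNode : (sphere k).newest.edgeSet → Node (k + 1)) :=
  Sum.inr_injective

theorem layer_oldNode (a : Node k) : layer (oldNode a) = layer a := rfl

theorem layer_newNode (e : (sphere k).newest.edgeSet) : layer (newNode e) = k + 1 := rfl

theorem layer_le (a : Node k) : layer a ≤ k := by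
  induction k with
  | zero => exact le_refl 0
  | succ k ih =>
    rcases node_cases a with ⟨a, rfl⟩ | ⟨e, rfl⟩
    · exact (ih a).trans (Nat.le_succ k)
    · exact le_refl _

theorem newest_not_adj_old_old (a b : Node k) :
    ¬ (sphere (k + 1)).newest.Adj (oldNode a) (oldNode b) := id

theorem newest_adj_old_new (a : Node k) (e : (sphere k).newest.edgeSet) :
    (sphere (k + 1)).newest.Adj (oldNode a) (newNode e) ↔ a ∈ e.1 := Iff.rfl

theorem newest_adj_new_new (e f : (sphere k).newest.edgeSet) :
    (sphere (k + 1)).newest.Adj (newNode e) (newNode f) ↔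
      ∃ a b c, (sphere k).newest.Adj a b ∧ (sphere k).newest.Adj a c ∧ (sphere k).newest.Adj b c ∧
        e.1 = s(a, b) ∧ f.1 = s(a, c) := Iff.rfl

theorem network_adj_succ (x y : Node (k + 1)) :
    (network (k + 1)).Adj x y ↔
      (∃ a b, (network k).Adj a b ∧ oldNode a = x ∧ oldNode b = y) ∨
        (sphere (k + 1)).newest.Adj x y := by
  have h : (network (k + 1)).Adj x y ↔
      ((network k).map (⟨oldNode, oldNode_injective⟩ : Node k ↪ Node (k + 1))).Adj x y ∨
        (sphere (k + 1)).newest.Adj x y := Iff.rfl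
  rw [h, SimpleGraph.map_adj]
  rfl

theorem newest_le_network : (sphere k).newest ≤ network k := by
  cases k with
  | zero => exact le_refl _
  | succ k => exact fun x y h => (network_adj_succ x y).mpr (Or.inr h)

theorem network_adj_old_old (a b : Node k) :
    (network (k + 1)).Adj (oldNode a) (oldNode b) ↔ (network k).Adj a b := by
  rw [network_adj_succ]
  constructor
  · rintro (⟨a', b', h, ha, hb⟩ | h)
    · rwa [← oldNode_injective ha, ← oldNode_injective hb]
    · exact absurd h (newest_not_adj_old_old a b)
  · exact fun h => Or.inl ⟨a, b, h, rfl, rfl⟩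

theorem network_adj_new_iff (e : (sphere k).newest.edgeSet) (y : Node (k + 1)) :
    (network (k + 1)).Adj (newNode e) y ↔ (sphere (k + 1)).newest.Adj (newNode e) y := by
  rw [network_adj_succ]
  constructor
  · rintro (⟨a, b, -, h, -⟩ | h)
    · exact absurd h Sum.inl_ne_inr
    · exact h
  · exact Or.inr

theorem mem_parents {a b : Node k} :
    b ∈ parents a ↔ (network k).Adj a b ∧ layer b < layer a := by
  simp [parents]

theorem mem_parents_oldNode {a : Node k} {x : Node (k + 1)} :
    x ∈ parents (oldNode a) ↔ ∃ b ∈ parents a, x = oldNode b := by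
  rw [mem_parents]
  constructor
  · rintro ⟨h, hl⟩
    rcases node_cases x with ⟨b, rfl⟩ | ⟨e, rfl⟩
    · exact ⟨b, mem_parents.mpr ⟨(network_adj_old_old a b).mp h, hl⟩, rfl⟩
    · rw [layer_newNode, layer_oldNode] at hl
      have := layer_le a
      omega
  · rintro ⟨b, hb, rfl⟩
    rw [mem_parents] at hb
    exact ⟨(network_adj_old_old a b).mpr hb.1, hb.2⟩

theorem mem_parents_newNode {e : (sphere k).newest.edgeSet} {x : Node (k + 1)} :
    x ∈ parents (newNode e) ↔ ∃ a ∈ e.1, x = oldNode a := by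
  rw [mem_parents, network_adj_new_iff]
  constructor
  · rintro ⟨h, hl⟩
    rcases node_cases x with ⟨b, rfl⟩ | ⟨e, rfl⟩
    · exact ⟨b, h, rfl⟩
    · exact absurd hl (lt_irrefl _)
  · rintro ⟨a, ha, rfl⟩
    exact ⟨ha, Nat.lt_succ_of_le (layer_le a)⟩

theorem parents_nonempty (a : Node k) (h : layer a ≠ 0) : (parents a).Nonempty := by
  induction k with
  | zero => exact absurd rfl h
  | succ k ih =>
    rcases node_cases a with ⟨a, rfl⟩ | ⟨e, rfl⟩
    · obtain ⟨b, hb⟩ := ih a h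
      exact ⟨oldNode b, mem_parents_oldNode.mpr ⟨b, hb, rfl⟩⟩
    · exact ⟨oldNode e.1.out.1, mem_parents_newNode.mpr ⟨_, e.1.out_fst_mem, rfl⟩⟩

/-- The ends of two edges of `(V_k, E_k)` that are equal or two sides of a triangle are pairwise
equal or adjacent. -/
theorem eq_or_adj_of_mem_edges {e f : (sphere k).newest.edgeSet}
    (h : e = f ∨ (sphere (k + 1)).newest.Adj (newNode e) (newNode f)) {p q : Node k}
    (hp : p ∈ e.1) (hq : q ∈ f.1) : p = q ∨ (sphere k).newest.Adj p q := by
  rcases h with rfl | h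
  · by_cases hpq : p = q
    · exact Or.inl hpq
    · right
      have := e.2
      rw [(Sym2.mem_and_mem_iff hpq).mp ⟨hp, hq⟩] at this
      exact this
  · obtain ⟨a, b, c, hab, hac, hbc, he, hf⟩ := (newest_adj_new_new e f).mp h
    rw [he, Sym2.mem_iff] at hp
    rw [hf, Sym2.mem_iff] at hq
    rcases hp with rfl | rfl <;> rcases hq with rfl | rfl
    · exact Or.inl rfl
    · exact Or.inr hac
    · exact Or.inr hab.symm
    · exact Or.inr hbc

/-- Equal layers mean that both nodes are old, which is the induction, or both belong to the last
round. In that case they lie on edges that coincide or are two sides of a triangle, and the parents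
are the ends of these edges. -/
theorem eq_or_adj_of_mem_parents {x y p q : Node k} (hl : layer x = layer y)
    (hxy : x = y ∨ (network k).Adj x y) (hp : p ∈ parents x) (hq : q ∈ parents y) :
    p = q ∨ (network k).Adj p q := by
  induction k with
  | zero => exact absurd (mem_parents.mp hp).2 (lt_irrefl 0)
  | succ k ih =>
    rcases node_cases x with ⟨x, rfl⟩ | ⟨e, rfl⟩ <;> rcases node_cases y with ⟨y, rfl⟩ | ⟨f, rfl⟩
    · obtain ⟨p, hp', rfl⟩ := mem_parents_oldNode.mp hp
      obtain ⟨q, hq', rfl⟩ := mem_parents_oldNode.mp hq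
      rw [network_adj_old_old, oldNode_injective.eq_iff] at hxy ⊢
      exact ih hl hxy hp' hq'
    · rw [layer_newNode, layer_oldNode] at hl
      have := layer_le x
      omega
    · rw [layer_newNode, layer_oldNode] at hl
      have := layer_le y
      omega
    · obtain ⟨p, hp', rfl⟩ := mem_parents_newNode.mp hp
      obtain ⟨q, hq', rfl⟩ := mem_parents_newNode.mp hq
      rw [network_adj_new_iff, newNode_injective.eq_iff] at hxy
      rw [network_adj_old_old, oldNode_injective.eq_iff]
      exact (eq_or_adj_of_mem_edges hxy hp' hq').imp_right fun h => newest_le_network h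

/-! ### Cliques within one layer have at most three nodes. -/

instance : DecidableRel icosahedron.Adj := fun a b =>
  inferInstanceAs (Decidable ((a, b) ∈ icosahedronEdges ∨ (b, a) ∈ icosahedronEdges))

theorem card_le_three_of_isClique_icosahedron (K : Finset (Fin 12))
    (hK : icosahedron.IsClique K) : K.card ≤ 3 := by
  -- The icosahedron has no four pairwise adjacent vertices, a finite check.
  have key : ∀ a b, icosahedron.Adj a b → ∀ c, icosahedron.Adj a c → icosahedron.Adj b c →
      ∀ d, icosahedron.Adj a d → icosahedron.Adj b d → ¬ icosahedron.Adj c d := by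
    decide +kernel
  by_contra! hcard
  obtain ⟨s, hs, hs4⟩ := Finset.exists_subset_card_eq hcard
  obtain ⟨a, b, c, d, hab, hac, had, hbc, hbd, hcd, rfl⟩ := Finset.card_eq_four.mp hs4
  have adj : ∀ x ∈ ({a, b, c, d} : Finset (Fin 12)), ∀ y ∈ ({a, b, c, d} : Finset (Fin 12)),
      x ≠ y → icosahedron.Adj x y := fun x hx y hy h => hK (hs hx) (hs hy) h
  simp only [Finset.mem_insert, Finset.mem_singleton] at adj
  exact key a b (adj a (by simp) b (by simp) hab) c (adj a (by simp) c (by simp) hac)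
    (adj b (by simp) c (by simp) hbc) d (adj a (by simp) d (by simp) had)
    (adj b (by simp) d (by simp) hbd) (adj c (by simp) d (by simp) hcd)

/-- Old and new nodes are turned into the nodes that they lie on. -/
noncomputable def support (x : Node (k + 1)) : Finset (Node k) := by
  classical
  exact Sum.elim (fun a => {a}) (fun e => e.1.toFinset) x

theorem support_oldNode (a : Node k) : support (oldNode a) = {a} := rfl

theorem mem_support_newNode {e : (sphere k).newest.edgeSet} {a : Node k} :
    a ∈ support (newNode e) ↔ a ∈ e.1 := by
  classical
  exact Sym2.mem_toFinset

/-- The supports of two adjacent nodes lie in a common edge or triangle, so a clique of the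
subdivision projects to a clique of the previous round. -/
theorem eq_or_newest_adj_of_mem_support {x y : Node (k + 1)}
    (h : x = y ∨ (sphere (k + 1)).newest.Adj x y) {p q : Node k}
    (hp : p ∈ support x) (hq : q ∈ support y) : p = q ∨ (sphere k).newest.Adj p q := by
  rcases node_cases x with ⟨x, rfl⟩ | ⟨e, rfl⟩ <;> rcases node_cases y with ⟨y, rfl⟩ | ⟨f, rfl⟩
  · rw [support_oldNode, Finset.mem_singleton] at hp hq
    subst hp hq
    exact Or.inl (h.elim (fun h => oldNode_injective h)
      fun h => absurd h (newest_not_adj_old_old _ _))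
  · rw [support_oldNode, Finset.mem_singleton] at hp
    subst hp
    have hpf : p ∈ f.1 := h.elim (fun h => absurd h Sum.inl_ne_inr) id
    exact eq_or_adj_of_mem_edges (Or.inl rfl) hpf (mem_support_newNode.mp hq)
  · rw [support_oldNode, Finset.mem_singleton] at hq
    subst hq
    have hqe : q ∈ e.1 := h.elim (fun h => absurd h Sum.inr_ne_inl) id
    exact eq_or_adj_of_mem_edges (Or.inl rfl) (mem_support_newNode.mp hp) hqe
  · exact eq_or_adj_of_mem_edges (h.imp_left fun h => newNode_injective h)
      (mem_support_newNode.mp hp) (mem_support_newNode.mp hq)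

/-- The union `P` of the supports is a clique one round earlier, so it has at most three nodes. If
`K` contains an old node $a$, its other members sit on distinct edges from $a$ to $P\setminus\{a\}$.
Otherwise the members have distinct supports among the at most $\binom{3}{2}=3$ pairs in `P`. -/
theorem card_le_three_of_isClique_newest (K : Finset (Node k))
    (hK : (sphere k).newest.IsClique K) : K.card ≤ 3 := by
  classical
  induction k with
  | zero => exact card_le_three_of_isClique_icosahedron K hK
  | succ k ih =>
    have hK' : ∀ x ∈ K, ∀ y ∈ K, x = y ∨ (sphere (k + 1)).newest.Adj x y :=
      fun x hx y hy => or_iff_not_imp_left.mpr fun h => hK hx hy h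
    let P := K.biUnion support
    have hP : P.card ≤ 3 := by
      refine ih P fun p hp q hq hpq => ?_
      obtain ⟨x, hx, hp⟩ := Finset.mem_biUnion.mp (Finset.mem_coe.mp hp)
      obtain ⟨y, hy, hq⟩ := Finset.mem_biUnion.mp (Finset.mem_coe.mp hq)
      exact (eq_or_newest_adj_of_mem_support (hK' x hx y hy) hp hq).resolve_left hpq
    have hsupp : ∀ x ∈ K, support x ⊆ P := fun x hx => Finset.subset_biUnion_of_mem support hx
    by_cases hold : ∃ a, oldNode a ∈ K
    · obtain ⟨a, ha⟩ := hold
      have hnew : ∀ x ∈ K, x ≠ oldNode a → ∃ b ∈ P.erase a, ∃ e : (sphere k).newest.edgeSet,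
          x = newNode e ∧ e.1 = s(a, b) := by
        intro x hx hxa
        have hadj := (hK' _ ha x hx).resolve_left (Ne.symm hxa)
        rcases node_cases x with ⟨b, rfl⟩ | ⟨e, rfl⟩
        · exact absurd hadj (newest_not_adj_old_old a b)
        · obtain ⟨b, hb⟩ := (newest_adj_old_new a e).mp hadj
          refine ⟨b, Finset.mem_erase.mpr ⟨?_, hsupp _ hx (mem_support_newNode.mpr ?_)⟩, e, rfl, hb⟩
          · rintro rfl
            have := e.2
            rw [hb] at this
            exact (sphere k).newest.loopless.irrefl _ this
          · rw [hb]
            exact Sym2.mem_mk_right a b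
      have : Nonempty (Node k) := ⟨a⟩
      choose! g hgP hg using hnew
      have haP : a ∈ P := hsupp _ ha (Finset.mem_singleton_self a)
      have : (K.erase (oldNode a)).card ≤ (P.erase a).card := by
        refine Finset.card_le_card_of_injOn g (fun x hx => ?_) fun x hx y hy hxy => ?_
        · have hx := Finset.mem_erase.mp hx
          exact hgP x hx.2 hx.1
        · have hx := Finset.mem_erase.mp hx
          have hy := Finset.mem_erase.mp hy
          obtain ⟨e, rfl, he⟩ := hg x hx.2 hx.1
          obtain ⟨f, rfl, hf⟩ := hg y hy.2 hy.1
          rw [hxy, ← hf] at he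
          rw [Subtype.ext he]
      rw [Finset.card_erase_of_mem ha, Finset.card_erase_of_mem haP] at this
      omega
    · have hmaps : ∀ x ∈ K, support x ∈ P.powersetCard 2 := by
        intro x hx
        rw [Finset.mem_powersetCard]
        refine ⟨hsupp x hx, ?_⟩
        rcases node_cases x with ⟨a, rfl⟩ | ⟨e, rfl⟩
        · exact absurd ⟨a, hx⟩ hold
        · exact Sym2.card_toFinset_of_not_isDiag _
            ((sphere k).newest.not_isDiag_of_mem_edgeSet e.2)
      refine (Finset.card_le_card_of_injOn support hmaps fun x hx y hy hxy => ?_).trans ?_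
      · rcases node_cases x with ⟨a, rfl⟩ | ⟨e, rfl⟩
        · exact absurd ⟨a, hx⟩ hold
        rcases node_cases y with ⟨a, rfl⟩ | ⟨f, rfl⟩
        · exact absurd ⟨a, hy⟩ hold
        congr 1
        refine Subtype.ext (Sym2.ext fun a => ?_)
        rw [← mem_support_newNode, ← mem_support_newNode, hxy]
      · rw [Finset.card_powersetCard]
        exact Nat.choose_le_choose 2 hP

/-- The nodes of `A` are on one layer and pairwise adjacent. -/
def IsLayerClique (A : Finset (Node k)) : Prop :=
  ∀ x ∈ A, ∀ y ∈ A, layer x = layer y ∧ (x = y ∨ (network k).Adj x y)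

theorem IsLayerClique.subset {A B : Finset (Node k)} (hA : IsLayerClique A) (h : B ⊆ A) :
    IsLayerClique B := fun x hx y hy => hA x (h hx) y (h hy)

theorem isLayerClique_singleton (a : Node k) : IsLayerClique {a} := by
  simp [IsLayerClique]

/-- The common layer prevents mixing edges of different rounds: if one node is from the last round,
all are, and all edges at such nodes were made in that round. Otherwise the clique already exists
one round earlier. -/
theorem IsLayerClique.card_le {A : Finset (Node k)} (hA : IsLayerClique A) : A.card ≤ 3 := by
  classical
  induction k with
  | zero => exact card_le_three_of_isClique_newest A fun x hx y hy h =>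
      (hA x hx y hy).2.resolve_left h
  | succ k ih =>
    by_cases hnew : ∃ e, newNode e ∈ A
    · obtain ⟨e, he⟩ := hnew
      refine card_le_three_of_isClique_newest A fun x hx y hy h => ?_
      have hadj := (hA x hx y hy).2.resolve_left h
      have hl := (hA _ hx _ he).1
      rcases node_cases x with ⟨a, rfl⟩ | ⟨f, rfl⟩
      · rw [layer_oldNode, layer_newNode] at hl
        have := layer_le a
        omega
      · exact (network_adj_new_iff f y).mp hadj
    · have hA' : A = (A.preimage oldNode oldNode_injective.injOn).image oldNode := by
        ext x
        simp only [Finset.mem_image, Finset.mem_preimage]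
        constructor
        · intro hx
          rcases node_cases x with ⟨a, rfl⟩ | ⟨e, rfl⟩
          · exact ⟨a, hx, rfl⟩
          · exact absurd ⟨e, hx⟩ hnew
        · rintro ⟨a, ha, rfl⟩
          exact ha
      rw [hA']
      refine Finset.card_image_le.trans (ih fun x hx y hy => ?_)
      have := hA _ (Finset.mem_preimage.mp hx) _ (Finset.mem_preimage.mp hy)
      rwa [network_adj_old_old, oldNode_injective.eq_iff] at this

/-! ## Labels -/

theorem mem_parentsOf {A : Finset (Node k)} {b : Node k} :
    b ∈ parentsOf A ↔ ∃ a ∈ A, b ∈ parents a := by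
  classical
  simp [parentsOf]

theorem mem_goodParents {A : Finset (Node k)} {b : Node k} :
    b ∈ goodParents A ↔ b ∈ parentsOf A ∧ ∀ c ∈ parentsOf A, layer b ≤ layer c := by
  simp [goodParents]

theorem nextRow_subset_goodParents (A : Finset (Node k)) : nextRow A ⊆ goodParents A := by
  classical
  unfold nextRow
  split_ifs
  · exact subset_rfl
  · exact Finset.filter_subset _ _

theorem IsLayerClique.nextRow {A : Finset (Node k)} (hA : IsLayerClique A) :
    IsLayerClique (nextRow A) := by
  refine IsLayerClique.subset (fun x hx y hy => ?_) (nextRow_subset_goodParents A)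
  rw [mem_goodParents] at hx hy
  obtain ⟨a, ha, hxa⟩ := mem_parentsOf.mp hx.1
  obtain ⟨b, hb, hyb⟩ := mem_parentsOf.mp hy.1
  exact ⟨le_antisymm (hx.2 y hy.1) (hy.2 x hx.1),
    eq_or_adj_of_mem_parents (hA a ha b hb).1 (hA a ha b hb).2 hxa hyb⟩

theorem goodParents_nonempty {A : Finset (Node k)} (hA : A.Nonempty)
    (h : ∀ a ∈ A, layer a ≠ 0) : (goodParents A).Nonempty := by
  obtain ⟨a, ha⟩ := hA
  obtain ⟨b, hb⟩ := parents_nonempty a (h a ha)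
  obtain ⟨c, hc, hmin⟩ := (parentsOf A).exists_min_image layer ⟨b, mem_parentsOf.mpr ⟨a, ha, hb⟩⟩
  exact ⟨c, mem_goodParents.mpr ⟨hc, hmin⟩⟩

/-- The grandparent rule cannot remove everything: a good parent of the set `B` of good parents is a
parent of some member of `B`, which therefore survives. -/
theorem nextRow_nonempty {A : Finset (Node k)} (hA : A.Nonempty)
    (h : ∀ a ∈ A, layer a ≠ 0) : (nextRow A).Nonempty := by
  classical
  have hB := goodParents_nonempty hA h
  unfold nextRow
  split_ifs with h0
  · exact hB
  · push Not at h0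
    obtain ⟨c, hc⟩ := goodParents_nonempty hB h0
    obtain ⟨b, hb, hcb⟩ := mem_parentsOf.mp (mem_goodParents.mp hc).1
    exact ⟨b, Finset.mem_filter.mpr ⟨hb, c, Finset.mem_inter.mpr ⟨hcb, hc⟩⟩⟩

theorem labelOfSet_of_pos {A : Finset (Node k)} (h : A.Nonempty ∧ ∀ a ∈ A, layer a ≠ 0) :
    labelOfSet A = A :: labelOfSet (nextRow A) := by
  rw [labelOfSet, dif_pos h]

theorem labelOfSet_of_not {A : Finset (Node k)} (h : ¬ (A.Nonempty ∧ ∀ a ∈ A, layer a ≠ 0)) :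
    labelOfSet A = [A] := by
  rw [labelOfSet, dif_neg h]

theorem getElem?_zero_labelOfSet (A : Finset (Node k)) : (labelOfSet A)[0]? = some A := by
  by_cases h : A.Nonempty ∧ ∀ a ∈ A, layer a ≠ 0
  · rw [labelOfSet_of_pos h]; rfl
  · rw [labelOfSet_of_not h]; rfl

/-- Induction along the rows of a label. -/
theorem labelOfSet_induction {motive : Finset (Node k) → Prop}
    (next : ∀ A : Finset (Node k), A.Nonempty → (∀ a ∈ A, layer a ≠ 0) → motive (nextRow A) →
      motive A)
    (last : ∀ A : Finset (Node k), ¬ (A.Nonempty ∧ ∀ a ∈ A, layer a ≠ 0) → motive A)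
    (A : Finset (Node k)) : motive A := by
  induction hn : A.sup layer using Nat.strong_induction_on generalizing A with
  | _ n ih =>
    by_cases h : A.Nonempty ∧ ∀ a ∈ A, layer a ≠ 0
    · exact next A h.1 h.2 (ih _ (hn ▸ sup_layer_nextRow_lt A h.1 h.2) _ rfl)
    · exact last A h

theorem length_labelOfSet_le (A : Finset (Node k)) :
    (labelOfSet A).length ≤ A.sup layer + 1 := by
  induction A using labelOfSet_induction with
  | next A hA h ih =>
    rw [labelOfSet_of_pos ⟨hA, h⟩, List.length_cons]
    have := sup_layer_nextRow_lt A hA h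
    omega
  | last A h =>
    rw [labelOfSet_of_not h]
    simp

theorem length_label_le (a : Node k) : (label a).length ≤ k + 1 := by
  refine (length_labelOfSet_le {a}).trans ?_
  rw [Finset.sup_singleton]
  exact Nat.succ_le_succ (layer_le a)

theorem card_le_of_mem_labelOfSet (A : Finset (Node k)) (hA : IsLayerClique A)
    {B : Finset (Node k)} (hB : B ∈ labelOfSet A) : B.card ≤ 3 := by
  induction A using labelOfSet_induction with
  | next A hne h ih =>
    rw [labelOfSet_of_pos ⟨hne, h⟩, List.mem_cons] at hB
    rcases hB with rfl | hB
    · exact hA.card_le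
    · exact ih hA.nextRow hB
  | last A h =>
    rw [labelOfSet_of_not h, List.mem_singleton] at hB
    exact hB ▸ hA.card_le

theorem card_le_of_mem_label {a : Node k} {B : Finset (Node k)} (hB : B ∈ label a) :
    B.card ≤ 3 :=
  card_le_of_mem_labelOfSet {a} (isLayerClique_singleton a) hB

/-- Rows stay nonempty, so the recursion can only stop on layer 0. -/
theorem exists_layer_zero_of_labelOfSet (A : Finset (Node k)) (hA : A.Nonempty) :
    ∃ B ∈ labelOfSet A, ∃ c ∈ B, layer c = 0 := by
  induction A using labelOfSet_induction with
  | next A hne h ih =>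
    obtain ⟨B, hB, hc⟩ := ih (nextRow_nonempty hne h)
    exact ⟨B, by rw [labelOfSet_of_pos ⟨hne, h⟩]; exact List.mem_cons_of_mem _ hB, hc⟩
  | last A h =>
    push Not at h
    exact ⟨A, by rw [labelOfSet_of_not (by push Not; exact h)]; exact List.mem_singleton_self A,
      h hA⟩

/-- Ensures that step 2 of the algorithm has something to choose from. -/
theorem exists_adj_of_mem_labelOfSet (A : Finset (Node k)) (i : ℕ) {B C : Finset (Node k)}
    (hB : (labelOfSet A)[i]? = some B) (hC : (labelOfSet A)[i + 1]? = some C) {a : Node k}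
    (ha : a ∈ C) : ∃ c ∈ B, (network k).Adj a c := by
  induction A using labelOfSet_induction generalizing i with
  | next A hne h ih =>
    rw [labelOfSet_of_pos ⟨hne, h⟩] at hB hC
    rw [List.getElem?_cons_succ] at hC
    cases i with
    | zero =>
      rw [getElem?_zero_labelOfSet] at hC
      cases hC
      cases hB
      obtain ⟨c, hc, hac⟩ := mem_parentsOf.mp (nextRow_subset _ ha)
      exact ⟨c, hc, (mem_parents.mp hac).1.symm⟩
    | succ i => exact ih i hB hC
  | last A h =>
    rw [labelOfSet_of_not h] at hC
    simp at hC

/-! ## Distances -/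

theorem edist_oldNode_le (a b : Node k) :
    (network (k + 1)).edist (oldNode a) (oldNode b) ≤ (network k).edist a b := by
  by_cases h : (network k).Reachable a b
  · obtain ⟨w, hw⟩ := h.exists_walk_length_eq_edist
    let f : network k →g network (k + 1) := ⟨oldNode, fun {a b} h => (network_adj_old_old a b).mpr h⟩
    rw [← hw, ← SimpleGraph.Walk.length_map f w]
    exact SimpleGraph.edist_le _
  · rw [SimpleGraph.edist_eq_top_of_not_reachable h]
    exact le_top

theorem icosahedron_edist_le (a : Fin 12) : icosahedron.edist 0 a ≤ 3 := by
  have key : ∀ a, a = 0 ∨ ∃ c, icosahedron.Adj 0 c ∧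
      (c = a ∨ ∃ d, icosahedron.Adj c d ∧ (d = a ∨ icosahedron.Adj d a)) := by
    decide +kernel
  rcases key a with rfl | ⟨c, hc, rfl | ⟨d, hd, rfl | h⟩⟩
  · simp
  · exact (SimpleGraph.edist_le hc.toWalk).trans (by norm_num)
  · exact (SimpleGraph.edist_le (.cons hc (.cons hd .nil))).trans (by norm_num)
  · exact (SimpleGraph.edist_le (.cons hc (.cons hd (.cons h .nil)))).trans (by norm_num)

/-- The detour through the pole `0` has length at most $3+3$, which already matches the radius of
the ball; later rounds keep all edges, so distances do not grow. -/
theorem edist_le_six_of_layer_eq_zero (a b : Node k) (ha : layer a = 0) (hb : layer b = 0) :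
    (network k).edist a b ≤ 6 := by
  induction k with
  | zero =>
    have h1 : icosahedron.edist a b ≤ icosahedron.edist a (0 : Fin 12) + icosahedron.edist 0 b :=
      SimpleGraph.edist_triangle
    exact h1.trans ((add_le_add (SimpleGraph.edist_comm.le.trans (icosahedron_edist_le a)) (icosahedron_edist_le b)).trans
      (by norm_num))
  | succ k ih =>
    rcases node_cases a with ⟨a, rfl⟩ | ⟨e, rfl⟩
    · rcases node_cases b with ⟨b, rfl⟩ | ⟨f, rfl⟩
      · exact (edist_oldNode_le a b).trans (ih a b ha hb)
      · exact absurd hb (Nat.succ_ne_zero k)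
    · exact absurd ha (Nat.succ_ne_zero k)

/-- A geodesic from the centre stays in the ball, since its initial segments bound the distances of
its nodes. -/
theorem exists_walk_in_sixBall {a c : Node k} (hc : c ∈ sixBall a) :
    ∃ w : (network k).Walk a c, (∀ v ∈ w.support, v ∈ sixBall a) ∧ w.length ≤ 6 := by
  classical
  have hc : (network k).edist a c ≤ 6 := hc
  have hr : (network k).Reachable a c := by
    by_contra h
    rw [SimpleGraph.edist_eq_top_of_not_reachable h] at hc
    exact absurd hc (by decide)
  obtain ⟨w, hw⟩ := hr.exists_walk_length_eq_edist
  have hlen : w.length ≤ 6 := by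
    rw [← hw] at hc
    exact_mod_cast hc
  refine ⟨w, fun v hv => (SimpleGraph.edist_le (w.takeUntil v hv)).trans ?_, hlen⟩
  exact_mod_cast (w.length_takeUntil_le_length hv).trans hlen

theorem IsDijkstraPath.length_le_seven {a c : Node k} {P : List (Node k)}
    (hP : IsDijkstraPath a c P) (hc : c ∈ sixBall a) : P.length ≤ 7 := by
  obtain ⟨w, -, -, rfl, hmin⟩ := hP
  obtain ⟨u, hu, hlen⟩ := exists_walk_in_sixBall hc
  have := hmin u hu
  rw [SimpleGraph.Walk.length_support]
  omega

/-- `Allowed.near` compares with every Dijkstra path, whereas the program only sees the stored ones.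
-/
theorem IsDijkstraPath.length_le {a c : Node k} {P Q : List (Node k)}
    (hP : IsDijkstraPath a c P) (hQ : IsDijkstraPath a c Q) : P.length ≤ Q.length := by
  obtain ⟨w, -, -, rfl, hmin⟩ := hP
  obtain ⟨u, -, hu, rfl, -⟩ := hQ
  simpa [SimpleGraph.Walk.length_support] using hmin u hu

theorem IsDijkstraPath.ne_nil {a c : Node k} {P : List (Node k)}
    (hP : IsDijkstraPath a c P) : P ≠ [] := by
  obtain ⟨w, -, -, rfl, -⟩ := hP
  exact w.support_ne_nil

/-! ## The number of nodes -/

/-- The new node on an edge splits it into two halves, both edges of the next round. -/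
theorem two_mul_card_edgeSet_le (k : ℕ) :
    2 * Nat.card (sphere k).newest.edgeSet ≤ Nat.card (sphere (k + 1)).newest.edgeSet := by
  have hfin (k : ℕ) : Finite (sphere k).newest.edgeSet := Subtype.finite
  let e₁ (e : (sphere k).newest.edgeSet) : (sphere (k + 1)).newest.edgeSet :=
    ⟨s(oldNode e.1.out.1, newNode e), e.1.out_fst_mem⟩
  let e₂ (e : (sphere k).newest.edgeSet) : (sphere (k + 1)).newest.edgeSet :=
    ⟨s(oldNode e.1.out.2, newNode e), e.1.out_snd_mem⟩
  have hne (a b : Node k) (e f : (sphere k).newest.edgeSet)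
      (h : s(oldNode a, newNode e) = s(oldNode b, newNode f)) : a = b ∧ e = f := by
    rcases Sym2.eq_iff.mp h with ⟨h₁, h₂⟩ | ⟨h₁, -⟩
    · exact ⟨oldNode_injective h₁, newNode_injective h₂⟩
    · exact absurd h₁ Sum.inl_ne_inr
  rw [two_mul, ← Nat.card_sum]
  refine Nat.card_le_card_of_injective (Sum.elim e₁ e₂) (Function.Injective.sumElim ?_ ?_ ?_)
  · exact fun e f h => (hne _ _ _ _ (congrArg Subtype.val h)).2
  · exact fun e f h => (hne _ _ _ _ (congrArg Subtype.val h)).2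
  -- If a half of one kind equals a half of the other kind, the two ends of the edge coincide, which
  -- would make it a loop.
  · intro e f h
    obtain ⟨h₁, rfl⟩ := hne _ _ _ _ (congrArg Subtype.val h)
    have h₂ : (sphere k).newest.Adj e.1.out.1 e.1.out.2 := by
      have hout : s(e.1.out.1, e.1.out.2) = e.1 := Quot.out_eq e.1
      rw [← SimpleGraph.mem_edgeSet, hout]
      exact e.2
    exact h₂.ne h₁

theorem two_pow_le_card_edgeSet (k : ℕ) : 2 ^ (k + 1) ≤ Nat.card (sphere k).newest.edgeSet := by
  induction k with
  | zero =>
    have : Finite (sphere 0).newest.edgeSet := Subtype.finite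
    have h₁ : icosahedron.Adj 0 1 := Or.inl (by decide)
    have h₂ : icosahedron.Adj 0 2 := Or.inl (by decide)
    have : Nontrivial (sphere 0).newest.edgeSet :=
      ⟨⟨s((0 : Fin 12), (1 : Fin 12)), h₁⟩, ⟨s((0 : Fin 12), (2 : Fin 12)), h₂⟩, fun h =>
        absurd (Sym2.congr_right.mp (congrArg Subtype.val h)) (by decide : (1 : Fin 12) ≠ 2)⟩
    exact Finite.one_lt_card
  | succ k ih =>
    have := two_mul_card_edgeSet_le k
    rw [pow_succ]
    omega

/-- Each round adds one node per edge, at least $2^{k+1}$ of them. This crude count is enough, as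
only a linear lower bound for $\log N$ is needed. -/
theorem two_pow_le_card_node (k : ℕ) : 2 ^ (k + 1) ≤ Nat.card (Node k) := by
  induction k with
  | zero =>
    change 2 ≤ Nat.card (Fin 12)
    simp
  | succ k ih =>
    have hfin : Finite (sphere k).newest.edgeSet := Subtype.finite
    have h : Nat.card (Node (k + 1)) = Nat.card (Node k) + Nat.card (sphere k).newest.edgeSet :=
      Nat.card_sum
    have := two_pow_le_card_edgeSet k
    rw [h, pow_succ]
    omega

theorem succ_mul_log_two_le (k : ℕ) : (k + 1 : ℝ) * Real.log 2 ≤ Real.log (Nat.card (Node k)) := by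
  have h : ((2 : ℝ) ^ (k + 1)) ≤ (Nat.card (Node k) : ℝ) := by
    exact_mod_cast two_pow_le_card_node k
  have := Real.log_le_log (by positivity) h
  rw [Real.log_pow] at this
  exact_mod_cast this

end Geometry

/-! ## The running time -/

section RunningTime

variable {k : ℕ}

theorem HashSet.Stores.length_eq {V : Type} {S : HashSet V} {A : Finset V}
    (h : S.Stores (A : Set V)) : S.elems.length = A.card := by
  classical
  rw [← List.toFinset_card_of_nodup S.nodup]
  congr 1
  ext x
  rw [List.mem_toFinset]
  exact h x

theorem StoresLabel.getElem? {L : List (HashSet (Node k))} {b : Node k} (h : StoresLabel L b)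
    {i : ℕ} {R : HashSet (Node k)} (hR : L[i]? = some R) :
    ∃ A : Finset (Node k), (label b)[i]? = some A ∧ R.Stores (A : Set (Node k)) := by
  obtain ⟨hi, rfl⟩ := List.getElem?_eq_some_iff.mp hR
  have hi' : i < (label b).length := List.Forall₂.length_eq h ▸ hi
  exact ⟨(label b)[i], List.getElem?_eq_getElem hi', List.Forall₂.get h hi hi'⟩

theorem StoresLabel.getElem?' {L : List (HashSet (Node k))} {b : Node k} (h : StoresLabel L b)
    {i : ℕ} {A : Finset (Node k)} (hA : (label b)[i]? = some A) :
    ∃ R : HashSet (Node k), L[i]? = some R ∧ R.Stores (A : Set (Node k)) := by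
  obtain ⟨hi, rfl⟩ := List.getElem?_eq_some_iff.mp hA
  have hi' : i < L.length := (List.Forall₂.length_eq h).symm ▸ hi
  exact ⟨L[i], List.getElem?_eq_getElem hi', List.Forall₂.get h hi' hi⟩

theorem StoresLabel.elems_length_le {L : List (HashSet (Node k))} {b : Node k}
    (h : StoresLabel L b) {R : HashSet (Node k)} (hR : R ∈ L) : R.elems.length ≤ 3 := by
  obtain ⟨i, hi⟩ := List.mem_iff_getElem?.mp hR
  obtain ⟨A, hA, hRA⟩ := h.getElem? hi
  rw [hRA.length_eq]
  exact card_le_of_mem_label (List.mem_of_getElem? hA)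

theorem StoresLabel.exists_mem_iff {L : List (HashSet (Node k))} {b : Node k}
    (h : StoresLabel L b) (x : Node k) : (∃ R ∈ L, x ∈ R.elems) ↔ x ∈ labelNodes b := by
  constructor
  · rintro ⟨R, hR, hx⟩
    obtain ⟨i, hi⟩ := List.mem_iff_getElem?.mp hR
    obtain ⟨A, hA, hRA⟩ := h.getElem? hi
    exact ⟨A, List.mem_of_getElem? hA, (hRA x).mp hx⟩
  · rintro ⟨A, hA, hx⟩
    obtain ⟨i, hi⟩ := List.mem_iff_getElem?.mp hA
    obtain ⟨R, hR, hRA⟩ := h.getElem?' hi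
    exact ⟨R, List.mem_of_getElem? hR, (hRA x).mpr hx⟩

/-- A node of layer `0` has a node of every label nearby. -/
theorem sixBall_inter_labelNodes_nonempty {a : Node k} (b : Node k) (ha : layer a = 0) :
    (sixBall a ∩ labelNodes b).Nonempty := by
  obtain ⟨B, hB, c, hc, hl⟩ := exists_layer_zero_of_labelOfSet {b} (Finset.singleton_nonempty b)
  exact ⟨c, edist_le_six_of_layer_eq_zero a c ha hl, B, hB, hc⟩

/-- The dominant term is the search for a shortest path: $2\cdot 7+4$ units for each of at most
$3(k+1)$ near nodes. The constant 200 and the intermediate budgets `c₂` are generous. -/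
theorem costs_localRoute {a b : Node k} {D : NodeData (Node k)} {q : Request (Node k)}
    (hD : D.IsFor a) (hq : q.IsFor b) :
    Costs (localRoute D q) (200 * (k + 1)) (Allowed a b) := by
  have hlen : q.label.length ≤ k + 1 :=
    (List.Forall₂.length_eq hq.label_eq).trans_le (length_label_le b)
  unfold localRoute
  refine (Costs.op_bind (c := 200 * (k + 1) - 1) fun y hy => ?_).mono (by omega) fun _ h => h
  have hy : y = true ↔ D.self = q.destination := hy
  rw [hD.self_eq, hq.destination_eq] at hy
  split_ifs with hyt
  · exact Costs.pure (.reached (hy.mp hyt))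
  have hab : a ≠ b := mt hy.mpr hyt
  refine Costs.bind (costs_rowBefore D.self q.label fun R hR => ?_)
    (c₂ := 200 * (k + 1) - 2 * (k + 1) - 2) ?_ (by omega)
  -- The first row is $\{b\}$, which misses $a$ because $a\ne b$.
  · obtain ⟨A, hA, hRA⟩ := hq.label_eq.getElem? hR
    rw [label, getElem?_zero_labelOfSet] at hA
    cases hA
    rw [hRA, hD.self_eq]
    simpa using hab
  rw [hD.self_eq]
  rintro _ (⟨rfl, hrows⟩ | ⟨i, R, S, hR, hS, haS, rfl⟩)
  · have ha : a ∉ labelNodes b := by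
      rw [← hq.label_eq.exists_mem_iff]
      rintro ⟨R, hR, h⟩
      exact hrows R hR h
    refine Costs.bind (costs_unionAll q.label 3 fun R hR => hq.label_eq.elems_length_le hR)
      (c₂ := 180 * (k + 1)) ?_ (by omega)
    rintro U ⟨hU, hUlen⟩
    refine Costs.bind (costs_intersect U D.ball.keys) (c₂ := 160 * (k + 1)) ?_ (by omega)
    rintro near ⟨hnear, hnearlen⟩
    have hnear : ∀ x, x ∈ near ↔ x ∈ sixBall a ∩ labelNodes b := fun x => by
      rw [hnear, hU, hq.label_eq.exists_mem_iff, hD.ball_eq x, Set.mem_inter_iff, and_comm]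
    refine (Costs.op_bind (c := 160 * (k + 1) - 1) fun y hy => ?_).mono (by omega) fun _ h => h
    cases near with
    | cons x l =>
      cases (show y = some (x, l) from hy)
      refine Costs.bind (costs_shortest D.ball (x :: l) 7 (List.cons_ne_nil x l)
        (fun c hc => (hD.ball_eq c).mpr ((hnear c).mp hc).1) fun c hc =>
          (hD.path_eq c ((hnear c).mp hc).1).length_le_seven ((hnear c).mp hc).1)
        (c₂ := 1) ?_ (by omega)
      rintro _ ⟨c, hc, rfl, hmin⟩
      have hcn := (hnear c).mp hc
      have hP := hD.path_eq c hcn.1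
      refine Costs.op_bind fun y hy => ?_
      obtain ⟨v, l', hvl⟩ := List.exists_cons_of_ne_nil hP.ne_nil
      rw [hvl] at hy
      cases (show y = some (v, l') from hy)
      have hl' : l' = (D.ball.value c).tail := by rw [hvl, List.tail_cons]
      rw [hl']
      exact Costs.pure (.near hab ha c hcn _ hP fun d hd Q hQ =>
        (hmin d ((hnear d).mpr hd)).trans ((hD.path_eq d hd.1).length_le hQ))
    | nil =>
      cases (show y = none from hy)
      have hfar : sixBall a ∩ labelNodes b = ∅ :=
        Set.eq_empty_of_forall_notMem fun x hx => List.not_mem_nil ((hnear x).mpr hx)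
      -- Hence the label of $a$ does not stop at its first row, and step 4 can read a second one.
      have hla : layer a ≠ 0 := fun h =>
        (sixBall_inter_labelNodes_nonempty b h).ne_empty hfar
      have hpos : ∀ x ∈ ({a} : Finset (Node k)), layer x ≠ 0 := by simpa using hla
      have hlabel : (label a)[1]? = some (nextRow {a}) := by
        rw [label, labelOfSet_of_pos ⟨Finset.singleton_nonempty a, hpos⟩,
          List.getElem?_cons_succ, getElem?_zero_labelOfSet]
      obtain ⟨R, hR, hRA⟩ := hD.label_eq.getElem?' hlabel
      obtain ⟨S, rows, hrows⟩ : ∃ S rows, D.label = S :: R :: rows := by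
        match hL : D.label with
        | [] => simp [hL] at hR
        | [S] => simp [hL] at hR
        | S :: R' :: rows =>
          rw [hL] at hR
          cases (show some R' = some R from hR)
          exact ⟨S, rows, rfl⟩
      rw [hrows]
      refine (Costs.op_bind (c := 159 * (k + 1) - 1) fun y hy => ?_).mono (by omega) fun _ h => h
      cases (show y = some (S, R :: rows) from hy)
      refine (Costs.op_bind (c := 100) fun y hy => ?_).mono (by omega) fun _ h => h
      cases (show y = some (R, rows) from hy)
      refine Costs.op_bind fun l hl => ?_
      cases (show l = R.elems from hl)
      have hRlen := hD.label_eq.elems_length_le (List.mem_of_getElem? hR)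
      obtain ⟨c, hc⟩ := nextRow_nonempty (Finset.singleton_nonempty a) hpos
      refine (costs_routeToRandom R.elems (List.ne_nil_of_mem ((hRA c).mpr hc))).mono
        (by omega) ?_
      rintro _ ⟨c, hc, rfl⟩
      exact .down hab ha hfar _ hlabel c ((hRA c).mp hc)
  · obtain ⟨B, hB, hRB⟩ := hq.label_eq.getElem? hR
    obtain ⟨A, hA, hSA⟩ := hq.label_eq.getElem? hS
    have haA : a ∈ A := (hSA a).mp haS
    have hRlen := hq.label_eq.elems_length_le (List.mem_of_getElem? hR)
    refine Costs.bind (costs_intersect R D.neighbours) (c₂ := 100) ?_ (by omega)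
    rintro l ⟨hl, hllen⟩
    obtain ⟨c, hc, hac⟩ := exists_adj_of_mem_labelOfSet {b} i hB hA haA
    have hcl : c ∈ l := (hl c).mpr ⟨(hRB c).mpr hc, (hD.neighbours_eq c).mpr hac⟩
    refine (costs_routeToRandom l (List.ne_nil_of_mem hcl)).mono (by omega) ?_
    rintro _ ⟨c, hc, rfl⟩
    obtain ⟨hcR, hcN⟩ := (hl c).mp hc
    exact .up hab i A B hB hA haA c ((hRB c).mp hcR) ((hD.neighbours_eq c).mp hcN)

end RunningTime

end SphereRouting

theorem mainTheorem12 :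
    ∃ C : ℝ, ∀ (k : ℕ) (a b : SphereRouting.Node k)
      (D : SphereRouting.NodeData (SphereRouting.Node k))
      (q : SphereRouting.Request (SphereRouting.Node k)),
      D.IsFor a → q.IsFor b →
      (∃ r t, SphereRouting.Runs (SphereRouting.localRoute D q) r t) ∧
      ∀ (r : SphereRouting.Outcome (SphereRouting.Node k)) (t : ℕ),
        SphereRouting.Runs (SphereRouting.localRoute D q) r t →
        SphereRouting.Allowed a b r ∧
        (t : ℝ) ≤ C * Real.log (Nat.card (SphereRouting.Node k)) := by
  -- Dividing by $\log 2$ converts $200(k+1)$ through $(k+1)\log 2\le\log N$.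
  refine ⟨200 / Real.log 2, fun k a b D q hD hq =>
    ⟨SphereRouting.Prog.exists_runs _, fun r t hr => ?_⟩⟩
  obtain ⟨ht, hallowed⟩ := SphereRouting.costs_localRoute hD hq r t hr
  refine ⟨hallowed, ?_⟩
  have h2 : 0 < Real.log 2 := Real.log_pos one_lt_two
  have ht' : (t : ℝ) ≤ 200 * (k + 1) := by exact_mod_cast ht
  calc (t : ℝ) ≤ 200 * (k + 1) := ht'
    _ = 200 / Real.log 2 * ((k + 1) * Real.log 2) := by field_simp
    _ ≤ _ := mul_le_mul_of_nonneg_left (SphereRouting.succ_mul_log_two_le k) (by positivity)
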